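/- **Model.** A network consists of $n\ge 1$ nodes, all running the same finite probabilistic state machine and starting in its start state. Each state is either beeping or receiving. In every synchronous round the nodes in beeping states beep; if at least one node beeps, all nodes choose their next state independently from the distribution $\delta_\top(\text{current state})$, and otherwise from $\delta_\bot(\text{current state})$. The machine has precision $q$ if all its transition probabilities are $0$, $1$, or in $[\frac1q,1-\frac1q]$. A state is terminal if it is never left. An execution has terminated once all nodes are in terminal states. A machine with a terminal leader state solves leader election with error $\varepsilon$ in a network of size $n$ if, with probability $1$, at least one node eventually enters the leader state, and, with probability at least $1-\varepsilon$, there is never more than one node in the leader state. **Universal algorithm (with $q=2$).** Every node keeps bits $active$ and $ko$, both initially $1$. It first calls a termination subroutine with parameters $(active,ko)$ and then sets $ko=0$. As long as the last call of the subroutine returned false, it repeats the following one-round iteration: flip a fair coin $participate\in\{0,1\}$; if $active=participate=1$, beep, and otherwise listen; if $active=1$, $participate=0$ and a beep is heard, set $active=0$ and $ko=1$; if nobody beeped in this round, call the termination subroutine with parameters $(active,ko)$ and then set $ko=0$. Once the subroutine has returned true, the node returns: it enters the (terminal) leader state if $active=1$ and a terminal non-leader state if $active=0$. **Constant State subroutine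 with constant $K$.** In the first round the nodes with $ko=1$ beep and all others listen; if nobody beeps, all nodes return false. Otherwise each node sets $solo=1$, $attack=1$, $count=0$, and the main body follows, in which odd and even rounds alternate, starting with an odd one. In an odd round each node with $active=1$ flips a fair coin and beeps on heads; a node with $active=1$ that listens and detects a beep sets $solo=0$; nodes with $active=0$ listen. In an even round each node with $attack=1$ flips a fair coin and beeps on heads; a node that listens and hears a beep sets $attack=0$; if nobody beeps, all nodes increment $count$ and set $attack=1$. The main body ends when $count>K$. In the final round the nodes with $active=1$ and $solo=0$ beep; if nobody beeps, all nodes return true, and otherwise all nodes return false. **Theorem.** For every real $c>0$ there are constants $K$, $s$ and $C$ (depending only on $c$) such that the universal algorithm combined with the Constant State subroutine with constant $K$ is a state machine with at most $s$ states and precision $q=2$, and for every network size $n\ge1$: 1. it solves leader election with error $n^{-c}$ in a network of size $n$: with probability $1$ at least one node eventually enters the leader state, and with probability at least $1-n^{-c}$ there is never more than one node in the leader state; 2. with probability at least $1-n^{-c}$ it terminates within $C\log^2 n$ rounds. -/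

import Mathlib

open MeasureTheory ProbabilityTheory

noncomputable section

namespace Beeping

/-! ## The single-hop beeping model -/

/-- A probabilistic state machine of the beeping model. The states with `beeps = true` are the
beeping states, all others are receiving states. `step true` is the transition function applied
in a round in which the node beeps or detects a beep, `step false` the one applied in silence. -/
structure Machine where
  State : Type
  [fintypeState : Fintype State]
  [decEqState : DecidableEq State]
  beeps : State → Bool
  start : State
  step : Bool → State → PMF State

attribute [instance] Machine.fintypeState Machine.decEqState

namespace Machine

variable (M : Machine)

instance : MeasurableSpace M.State := ⊤

instance : DiscreteMeasurableSpace M.State := ⟨fun _ => trivial⟩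

/-- A configuration of a network of `n` nodes: the current state of every node. -/
abbrev Config (n : ℕ) : Type := Fin n → M.State

/-- Whether at least one node beeps in the configuration `σ`. -/
def busy {n : ℕ} (σ : M.Config n) : Bool := decide (∃ u, M.beeps (σ u) = true)

/-- The law of the configuration after one round played from `σ`: the nodes choose their next
states independently, all according to the same channel outcome. -/
def roundLaw {n : ℕ} (σ : M.Config n) : Measure (M.Config n) :=
  Measure.pi fun u => (M.step (M.busy σ) (σ u)).toMeasure

instance {n : ℕ} (σ : M.Config n) : IsProbabilityMeasure (M.roundLaw σ) := by
  unfold roundLaw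
  infer_instance

/-- The transition kernel of round `t + 1`: given the history up to time `t`, the next
configuration has law `roundLaw` of the configuration at time `t`. -/
def roundKernel (n t : ℕ) :
    Kernel ((_i : Finset.Iic t) → M.Config n) (M.Config n) :=
  Kernel.ofFunOfCountable fun h => M.roundLaw (h ⟨t, Finset.mem_Iic.2 le_rfl⟩)

instance (n t : ℕ) : IsMarkovKernel (M.roundKernel n t) :=
  ⟨fun h => inferInstanceAs
    (IsProbabilityMeasure (M.roundLaw (h ⟨t, Finset.mem_Iic.2 le_rfl⟩)))⟩

/-- The law of the execution of `M` in a network of `n` nodes, all of them starting in the start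
state. A sample `ω : ℕ → M.Config n` lists the configurations `ω t` after `t` rounds. -/
def executionLaw (n : ℕ) : Measure (ℕ → M.Config n) :=
  Kernel.traj (X := fun _ => M.Config n) (M.roundKernel n) 0 fun _ _ => M.start

/-- A state that is never left once it is entered. -/
def IsTerminal (s : M.State) : Prop := ∀ b, M.step b s = PMF.pure s

/-- Every transition probability is `0`, `1` or lies in `[1/q, 1 - 1/q]`. -/
def HasPrecision (q : ℕ) : Prop :=
  ∀ b s s', M.step b s s' = 0 ∨ M.step b s s' = 1 ∨
    (M.step b s s').toReal ∈ Set.Icc (1 / (q : ℝ)) (1 - 1 / (q : ℝ))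

/-- `M`, with leader state `ℓ`, solves leader election with error `ε` in a network of `n` nodes. -/
structure SolvesLeaderElection (ℓ : M.State) (n : ℕ) (ε : ℝ) : Prop where
  terminal : M.IsTerminal ℓ
  liveness : ∀ᵐ ω ∂(M.executionLaw n), ∃ t u, ω t u = ℓ
  safety : 1 - ε ≤ (M.executionLaw n).real {ω | ∀ t u v, ω t u = ℓ → ω t v = ℓ → u = v}

/-- The execution `ω` has terminated after at most `r` rounds: by then every node is in a
terminal state. -/
def TerminatesWithin {n : ℕ} (ω : ℕ → M.Config n) (r : ℝ) : Prop :=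
  ∃ t : ℕ, (t : ℝ) ≤ r ∧ ∀ u, M.IsTerminal (ω t u)

end Machine

/-- A fair coin. -/
def coin : PMF Bool := PMF.uniformOfFintype Bool

/-! ## The universal leader election algorithm -/

/-- A termination subroutine. A call with parameters `active` and `ko` starts in state
`init active ko`. The parameter `active` does not change during the call and is available in every
round. After each round the subroutine either continues in a new state (`Sum.inl`) or
returns a Boolean (`Sum.inr`). -/
structure TerminationSubroutine where
  State : Type
  [fintypeState : Fintype State]
  [decEqState : DecidableEq State]
  init : (active ko : Bool) → State
  beeps : (active : Bool) → State → Bool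
  step : (active heard : Bool) → State → PMF (State ⊕ Bool)

attribute [instance] TerminationSubroutine.fintypeState TerminationSubroutine.decEqState

/-- States of the universal algorithm: an iteration of the knockout loop, a round of the
termination subroutine, or having returned (as leader or as non-leader). -/
inductive UState (S : Type) where
  | loop (active ko participate : Bool)
  | sub (active : Bool) (s : S)
  | leader
  | nonleader
  deriving DecidableEq, Fintype

/-- The start of an iteration of the knockout loop, in which the node draws `participate`. -/
def enterLoop {S : Type} (active ko : Bool) : PMF (UState S) :=
  coin.map (UState.loop active ko)

/-- The universal algorithm (with precision `2`) combined with the termination subroutine `T`. -/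
def universal (T : TerminationSubroutine) : Machine where
  State := UState T.State
  start := .sub true (T.init true true)
  beeps
    | .loop active _ participate => active && participate
    | .sub active s => T.beeps active s
    | .leader => false
    | .nonleader => false
  step
    -- a silent iteration is followed by a call of the subroutine
    | false, .loop active ko _ => PMF.pure (.sub active (T.init active ko))
    -- otherwise an active node that listened has heard a beep, and is knocked out
    | true, .loop active ko participate =>
        if active && !participate then enterLoop false true else enterLoop active ko
    | heard, .sub active s => (T.step active heard s).bind fun
        | .inl s' => PMF.pure (.sub active s')
        | .inr true => PMF.pure (if active then .leader else .nonleader)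
        | .inr false => enterLoop active false
    | _, .leader => PMF.pure .leader
    | _, .nonleader => PMF.pure .nonleader

/-- The leader state of the universal algorithm. -/
def leaderState (T : TerminationSubroutine) : (universal T).State := UState.leader

/-! ## The Constant State termination subroutine -/

/-- States of the Constant State subroutine with constant `K`. In the main body
`count` takes the values `0, …, K`; `beep` is the outcome of the decision to beep in the
current round. -/
inductive CState (K : ℕ) where
  | first (ko : Bool)
  | odd (solo attack beep : Bool) (count : Fin (K + 1))
  | even (solo attack beep : Bool) (count : Fin (K + 1))
  | last (solo : Bool)
  deriving DecidableEq, Fintype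

/-- The start of an odd round: active nodes flip a fair coin to decide whether to beep. -/
def enterOdd {K : ℕ} (active solo attack : Bool) (count : Fin (K + 1)) :
    PMF (CState K ⊕ Bool) :=
  if active then coin.map fun beep => .inl (.odd solo attack beep count)
  else PMF.pure (.inl (.odd solo attack false count))

/-- The start of an even round: nodes with `attack = true` flip a fair coin to decide whether
to beep. -/
def enterEven {K : ℕ} (solo attack : Bool) (count : Fin (K + 1)) :
    PMF (CState K ⊕ Bool) :=
  if attack then coin.map fun beep => .inl (.even solo attack beep count)
  else PMF.pure (.inl (.even solo attack false count))

/-- The Constant State termination subroutine: the main body ends when `count` exceeds `K`. -/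
def constantState (K : ℕ) : TerminationSubroutine where
  State := CState K
  init _ ko := .first ko
  beeps
    | _, .first ko => ko
    | _, .odd _ _ beep _ => beep
    | _, .even _ _ beep _ => beep
    | active, .last solo => active && !solo
  step
    | _, false, .first _ => PMF.pure (.inr false)
    | active, true, .first _ => enterOdd active true true 0
    -- an active node that receives and detects a beep resets `solo`
    | active, heard, .odd solo attack beep count =>
        enterEven (solo && !(active && !beep && heard)) attack count
    -- a node that receives and hears a beep resets `attack`
    | active, true, .even solo attack beep count => enterOdd active solo (attack && beep) count
    -- a silent even round: increment `count` and restore `attack`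
    | active, false, .even solo _ _ count =>
        if h : (count : ℕ) + 1 < K + 1 then enterOdd active solo true ⟨count + 1, h⟩
        else PMF.pure (.inl (.last solo))
    | _, heard, .last _ => PMF.pure (.inr (!heard))

end Beeping

end

noncomputable section

namespace Beeping

/-! Every transition is a function of the channel outcome, the current state and one fair coin, so
the expectation of an observable after `T` rounds is the `T`-th iterate of a finite averaging
operator (`integral_execution`). Safety and termination then become inductions on `T` along the few
kinds of configuration in which all nodes are at the same point of the program.

Safety (`safetyBounds`). A call of the subroutine can wrongly return true only if at least two nodes
are active and all of them stay solo, that is, take the same decision in every odd round. Each odd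
round lets this happen with probability at most 1/2. If `m` nodes attack, the weight `1/(m+1)` at
most doubles on average when each attacker survives with probability 1/2. The two factors cancel, so
a phase between silent even rounds, which starts with `n` attackers, contributes a factor `r =
1/(n+1)`, and the `K+1` phases of a call contribute `r^(K+1)`. A call is risky only when `ko` is set
somewhere. After the first call this needs a fresh knockout, so there are at most `n` risky calls,
and the total error is at most `(n+1)^(-K)`.

Termination (`pending_start_le`). The expected number of attackers halves every two rounds, so a
phase outlasts about `2t` rounds with probability at most `n 2^(-t)`. A knockout iteration
multiplies the expected number of active nodes by at most 3/4, where a lone active node in a silent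
iteration counts as zero because the ensuing call succeeds. With `J` iterations and `t = J` the
failure probability is `O(n (3/4)^J)` within `O(J^2)` rounds. Taking `J` of order `log n` gives the
running time, and letting `J` tend to infinity gives liveness. -/

/-- The average of `F` over independent fair coins, one for every node. -/
def coinAvg {n : ℕ} (F : (Fin n → Bool) → ℝ) : ℝ := Finset.univ.expect F

/-! ### Averages over independent fair coins. -/

section coinAvg

variable {n : ℕ} {F G : (Fin n → Bool) → ℝ}

theorem coinAvg_mono (h : ∀ b, F b ≤ G b) : coinAvg F ≤ coinAvg G :=
  Finset.expect_le_expect fun b _ => h b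

theorem coinAvg_le {a : ℝ} (h : ∀ b, F b ≤ a) : coinAvg F ≤ a :=
  Finset.expect_le Finset.univ_nonempty fun b _ => h b

@[simp]
theorem coinAvg_const (a : ℝ) : coinAvg (fun _ : Fin n → Bool => a) = a :=
  Finset.expect_const Finset.univ_nonempty a

theorem coinAvg_add (F G : (Fin n → Bool) → ℝ) :
    coinAvg (fun b => F b + G b) = coinAvg F + coinAvg G :=
  Finset.expect_add_distrib _ _ _

theorem coinAvg_mul_left (a : ℝ) (F : (Fin n → Bool) → ℝ) :
    coinAvg (fun b => a * F b) = a * coinAvg F :=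
  (Finset.mul_expect _ _ _).symm

theorem coinAvg_eq_sum (F : (Fin n → Bool) → ℝ) : coinAvg F = (1 / 2 : ℝ) ^ n * ∑ b, F b := by
  rw [coinAvg, Finset.expect_eq_sum_div_card]
  simp [div_eq_inv_mul]

end coinAvg

theorem coin_apply (b : Bool) : coin b = 2⁻¹ := by
  simp [coin]

/-! ### Coin-driven machines: the execution law through iterates of the one-round operator. -/

namespace Machine

variable (M : Machine) (next : Bool → M.State → Bool → M.State) {n : ℕ}

/-- The configuration after a round played from `σ` in which the nodes, moving according to
`next`, draw the coins `b`. -/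
def nextConfig (σ : M.Config n) (b : Fin n → Bool) : M.Config n :=
  fun u => next (M.busy σ) (σ u) (b u)

/-- The expectation of `f` after one round. -/
def roundOp (f : M.Config n → ℝ) (σ : M.Config n) : ℝ :=
  coinAvg fun b => f (M.nextConfig next σ b)

variable {M next}

/-- The product of the nodes' transition laws is the image of the uniform measure on coin vectors,
each of which has mass `2^(-n)`. -/
theorem integral_roundLaw (hM : ∀ h s, M.step h s = coin.map (next h s))
    (σ : M.Config n) (f : M.Config n → ℝ) :
    ∫ τ, f τ ∂(M.roundLaw σ) = M.roundOp next f σ := by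
  have hlaw : M.roundLaw σ =
      (Measure.pi fun _ : Fin n => coin.toMeasure).map (M.nextConfig next σ) := by
    unfold roundLaw
    have h1 : ∀ u, (M.step (M.busy σ) (σ u)).toMeasure =
        coin.toMeasure.map (next (M.busy σ) (σ u)) := fun u => by
      rw [hM]
      exact (PMF.toMeasure_map _ coin Measurable.of_discrete).symm
    have : ∀ u, SigmaFinite (coin.toMeasure.map (next (M.busy σ) (σ u))) := fun u => by
      rw [← h1]; infer_instance
    simp_rw [h1]
    exact (Measure.pi_map_pi fun u => Measurable.of_discrete.aemeasurable).symm
  rw [hlaw, integral_map Measurable.of_discrete.aemeasurable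
    Measurable.of_discrete.aestronglyMeasurable, integral_fintype .of_finite, roundOp,
    coinAvg_eq_sum, Finset.mul_sum]
  refine Finset.sum_congr rfl fun b _ => ?_
  have : (Measure.pi fun _ : Fin n => coin.toMeasure).real {b} = (1 / 2 : ℝ) ^ n := by
    rw [measureReal_def, Measure.pi_singleton]
    simp [coin_apply]
  rw [this, smul_eq_mul]

/-- The law of two consecutive configurations. -/
theorem integral_execution_succ (hM : ∀ h s, M.step h s = coin.map (next h s))
    (t : ℕ) (g : M.Config n → M.Config n → ℝ) :
    ∫ ω, g (ω t) (ω (t + 1)) ∂(M.executionLaw n) =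
      ∫ ω, M.roundOp next (g (ω t)) (ω t) ∂(M.executionLaw n) := by
  -- The joint law of the history up to `t` and the next configuration is a composition product,
  -- whose inner integral is the one-round operator.
  have hj := Kernel.partialTraj_compProd_eq_map_traj (X := fun _ => M.Config n)
    (κ := M.roundKernel n) (zero_le (a := t)) (x₀ := fun _ => fun _ => M.start)
  let G : ((_i : Finset.Iic t) → M.Config n) × M.Config n → ℝ :=
    fun p => g (p.1 ⟨t, Finset.mem_Iic.2 le_rfl⟩) p.2
  have h1 : ∫ ω, g (ω t) (ω (t + 1)) ∂(M.executionLaw n) =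
      ∫ p, G p ∂((M.executionLaw n).map
        (fun x => (Preorder.frestrictLe (π := fun _ => M.Config n) t x, x (t + 1)))) := by
    rw [integral_map (by fun_prop) Measurable.of_discrete.aestronglyMeasurable]
    rfl
  rw [h1, executionLaw, ← hj, Measure.integral_compProd .of_finite]
  rw [← Kernel.traj_map_frestrictLe_apply, integral_map (by fun_prop)
    Measurable.of_discrete.aestronglyMeasurable]
  refine integral_congr_ae (ae_of_all _ fun ω => ?_)
  exact integral_roundLaw hM (ω t) (g (ω t))

theorem execution_zero : ∀ᵐ ω ∂(M.executionLaw n), ω 0 = fun _ => M.start := by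
  have h := Kernel.traj_map_frestrictLe_apply (X := fun _ => M.Config n)
    (κ := M.roundKernel n) 0 0 (fun _ => fun _ => M.start)
  rw [Kernel.partialTraj_self, Kernel.id_apply] at h
  have h2 : ∀ᵐ x ∂(Measure.map (Preorder.frestrictLe (π := fun _ => M.Config n) 0)
      (M.executionLaw n)), x ⟨0, Finset.mem_Iic.2 le_rfl⟩ = fun _ => M.start := by
    rw [executionLaw, h]
    simp [ae_dirac_eq]
  exact ae_of_ae_map (by fun_prop) h2

instance : IsProbabilityMeasure (M.executionLaw n) := by
  unfold executionLaw
  infer_instance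

theorem integral_execution (hM : ∀ h s, M.step h s = coin.map (next h s))
    (t : ℕ) (f : M.Config n → ℝ) :
    ∫ ω, f (ω t) ∂(M.executionLaw n) = (M.roundOp next)^[t] f fun _ => M.start := by
  induction t generalizing f with
  | zero =>
    rw [integral_congr_ae (execution_zero.mono fun ω h => by rw [h])]
    simp
  | succ t ih =>
    rw [integral_execution_succ hM t fun _ => f, ih, Function.iterate_succ_apply]

theorem measure_execution (hM : ∀ h s, M.step h s = coin.map (next h s))
    (t : ℕ) (A : Set (M.Config n)) :
    (M.executionLaw n).real {ω | ω t ∈ A} =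
      (M.roundOp next)^[t] (A.indicator 1) fun _ => M.start := by
  rw [← integral_execution hM, ← integral_indicator_one]
  · rfl
  · exact measurable_pi_apply t (MeasurableSet.of_discrete (s := A))

/-- Leaving a closed set in a given round has expected indicator zero, and there are countably many
rounds. -/
theorem execution_mem_succ (hM : ∀ h s, M.step h s = coin.map (next h s))
    {A : Set (M.Config n)} (hA : ∀ σ ∈ A, ∀ b, M.nextConfig next σ b ∈ A) :
    ∀ᵐ ω ∂(M.executionLaw n), ∀ t, ω t ∈ A → ω (t + 1) ∈ A := by
  classical
  refine ae_all_iff.2 fun t => ?_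
  have h := integral_execution_succ (n := n) hM t fun σ τ => if σ ∈ A ∧ τ ∉ A then 1 else 0
  have h0 : ∀ σ : M.Config n,
      M.roundOp next (fun τ => if σ ∈ A ∧ τ ∉ A then (1 : ℝ) else 0) σ = 0 := fun σ => by
    have : ∀ b, (if σ ∈ A ∧ M.nextConfig next σ b ∉ A then (1 : ℝ) else 0) = 0 := fun b =>
      if_neg fun hc => hc.2 (hA σ hc.1 b)
    simp only [roundOp, this, coinAvg_const]
  simp only [h0, integral_zero] at h
  have hm : Measurable fun ω : ℕ → M.Config n =>
      if ω t ∈ A ∧ ω (t + 1) ∉ A then (1 : ℝ) else 0 :=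
    Measurable.comp (g := fun p : M.Config n × M.Config n =>
      if p.1 ∈ A ∧ p.2 ∉ A then (1 : ℝ) else 0) (f := fun ω : ℕ → M.Config n => (ω t, ω (t + 1)))
      Measurable.of_discrete ((measurable_pi_apply t).prodMk (measurable_pi_apply (t + 1)))
  rw [integral_eq_zero_iff_of_nonneg (fun ω => by dsimp; split_ifs <;> simp)
    (Integrable.of_bound hm.aestronglyMeasurable 1
      (ae_of_all _ fun ω => by dsimp; split_ifs <;> simp))] at h
  filter_upwards [h] with ω hω h1
  by_contra h2
  simp [h1, h2] at hω

section roundOp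

variable {f : M.Config n → ℝ}

theorem roundOp_iterate_succ (T : ℕ) (f : M.Config n → ℝ) (σ : M.Config n) :
    (M.roundOp next)^[T + 1] f σ = coinAvg fun b => (M.roundOp next)^[T] f (M.nextConfig next σ b) := by
  rw [Function.iterate_succ_apply']
  rfl

theorem roundOp_iterate_le {a : ℝ} (hf : ∀ σ, f σ ≤ a) (T : ℕ) (σ : M.Config n) :
    (M.roundOp next)^[T] f σ ≤ a := by
  induction T generalizing σ with
  | zero => exact hf σ
  | succ T ih => rw [roundOp_iterate_succ]; exact coinAvg_le fun b => ih _

theorem roundOp_iterate_eq_zero {A : Set (M.Config n)}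
    (hA : ∀ σ ∈ A, ∀ b, M.nextConfig next σ b ∈ A) (hf : ∀ σ ∈ A, f σ = 0) (T : ℕ)
    {σ : M.Config n} (hσ : σ ∈ A) : (M.roundOp next)^[T] f σ = 0 := by
  induction T generalizing σ with
  | zero => exact hf σ hσ
  | succ T ih => simp only [roundOp_iterate_succ, ih (hA σ hσ _), coinAvg_const]

theorem roundOp_iterate_antitone (hf : ∀ σ b, f (M.nextConfig next σ b) ≤ f σ)
    (σ : M.Config n) : Antitone fun T => (M.roundOp next)^[T] f σ := by
  refine antitone_nat_of_succ_le fun T => ?_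
  induction T generalizing σ with
  | zero => exact coinAvg_le fun b => hf σ b
  | succ T ih =>
    rw [roundOp_iterate_succ, roundOp_iterate_succ T]
    exact coinAvg_mono fun b => ih _

end roundOp

end Machine

/-! ### Counting nodes and estimates for binomial thinning. -/

section Coins

variable {n : ℕ}

/-- The number of nodes at which `a` is true. -/
def cnt (a : Fin n → Bool) : ℕ := (Finset.univ.filter fun u => a u = true).card

theorem cnt_eq_zero {a : Fin n → Bool} : cnt a = 0 ↔ ¬∃ u, a u = true := by
  simp [cnt, Finset.filter_eq_empty_iff]

theorem cnt_pos {a : Fin n → Bool} : 0 < cnt a ↔ ∃ u, a u = true := by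
  rw [Nat.pos_iff_ne_zero, ne_eq, cnt_eq_zero, not_not]

theorem cnt_mono {a b : Fin n → Bool} (h : ∀ u, a u = true → b u = true) : cnt a ≤ cnt b :=
  Finset.card_le_card fun u hu => by simpa using h u (by simpa using hu)

theorem cnt_lt {a b : Fin n → Bool} (h : ∀ u, a u = true → b u = true) {v : Fin n}
    (hv : b v = true) (hv' : ¬a v = true) : cnt a < cnt b :=
  Finset.card_lt_card <| Finset.ssubset_iff_subset_ne.2
    ⟨fun u hu => by simpa using h u (by simpa using hu), fun he => hv' (by
      have : v ∈ Finset.univ.filter fun u => a u = true := he ▸ by simpa using hv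
      simpa using this)⟩

theorem cnt_true : cnt (fun _ : Fin n => true) = n := by simp [cnt]

theorem cnt_le (a : Fin n → Bool) : cnt a ≤ n := by
  simpa [cnt_true] using cnt_mono (a := a) (b := fun _ => true) (by simp)

theorem cnt_le_one {a : Fin n → Bool} :
    cnt a ≤ 1 ↔ ∀ u v, a u = true → a v = true → u = v := by
  simp only [cnt, Finset.card_le_one, Finset.mem_filter, Finset.mem_univ, true_and]
  exact ⟨fun h u v hu hv => h u hu v hv, fun h u hu v hv => h u v hu hv⟩

theorem coinAvg_not (F : (Fin n → Bool) → ℝ) : coinAvg (fun b => F fun u => !b u) = coinAvg F :=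
  Fintype.expect_equiv (Function.Involutive.toPerm (fun (b : Fin n → Bool) u => !b u)
    fun b => by simp) _ _ fun _ => rfl

theorem coinAvg_flip (v : Fin n) (F : (Fin n → Bool) → ℝ) :
    coinAvg (fun b => F (Function.update b v (!b v))) = coinAvg F :=
  Fintype.expect_equiv (Function.Involutive.toPerm
    (fun (b : Fin n → Bool) => Function.update b v (!b v)) fun b => by simp) _ _ fun _ => rfl

/-- The nodes of `S` with heads form a uniformly random subset of `S`. The induction pairs each coin
vector with the one flipped at the new node. -/
theorem coinAvg_card_filter (S : Finset (Fin n)) (f : ℕ → ℝ) :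
    coinAvg (fun b => f (S.filter fun u => b u = true).card) =
      (1 / 2 : ℝ) ^ S.card * ∑ Y ∈ S.powerset, f Y.card := by
  induction S using Finset.induction_on generalizing f with
  | empty => simp
  | insert v S hv ih =>
    have h1 : ∀ b : Fin n → Bool,
        f ((insert v S).filter fun u => b u = true).card +
          f ((insert v S).filter fun u => Function.update b v (!b v) u = true).card =
        f (S.filter fun u => b u = true).card + f ((S.filter fun u => b u = true).card + 1) := by
      intro b
      have hS : (S.filter fun u => Function.update b v (!b v) u = true) =
          S.filter fun u => b u = true := by
        refine Finset.filter_congr fun u hu => ?_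
        rw [Function.update_of_ne (ne_of_mem_of_not_mem hu hv)]
      have hv' : v ∉ S.filter fun u => b u = true := fun h => hv (Finset.mem_filter.1 h).1
      rw [Finset.filter_insert, Finset.filter_insert, hS]
      cases hb : b v <;> simp [hv', add_comm]
    have h2 : 2 * coinAvg (fun b => f ((insert v S).filter fun u => b u = true).card) =
        coinAvg (fun b => f (S.filter fun u => b u = true).card) +
          coinAvg (fun b => f ((S.filter fun u => b u = true).card + 1)) := by
      rw [← coinAvg_add, two_mul]
      nth_rw 2 [← coinAvg_flip v]
      rw [← coinAvg_add]
      exact congrArg coinAvg (funext h1)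
    rw [ih, ih fun j => f (j + 1)] at h2
    rw [Finset.sum_powerset_insert hv, Finset.card_insert_of_notMem hv, pow_succ]
    have h3 : ∑ Y ∈ S.powerset, f (insert v Y).card = ∑ Y ∈ S.powerset, f (Y.card + 1) :=
      Finset.sum_congr rfl fun Y hY => by
        rw [Finset.card_insert_of_notMem fun h => hv (Finset.mem_powerset.1 hY h)]
    rw [h3]
    linarith

theorem coinAvg_cnt_and (a : Fin n → Bool) (f : ℕ → ℝ) :
    coinAvg (fun b => f (cnt fun u => a u && b u)) =
      (1 / 2 : ℝ) ^ cnt a * ∑ j ∈ Finset.range (cnt a + 1), (cnt a).choose j * f j := by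
  have h := coinAvg_card_filter (Finset.univ.filter fun u => a u = true) f
  simp only [Finset.filter_filter] at h
  simp only [cnt, Bool.and_eq_true]
  rw [h, Finset.sum_powerset_apply_card]
  simp

theorem coinAvg_cnt (a : Fin n → Bool) :
    coinAvg (fun b => (cnt fun u => a u && b u : ℝ)) = cnt a / 2 := by
  have h : ∀ b : Fin n → Bool,
      (cnt fun u => a u && b u : ℝ) + (cnt fun u => a u && !b u : ℝ) = cnt a := by
    intro b
    rw [← Nat.cast_add, cnt, cnt, cnt, ← Finset.card_union_of_disjoint]
    · congr 2
      ext u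
      cases ha : a u <;> cases hb : b u <;> simp [ha, hb]
    · rw [Finset.disjoint_filter]
      intro u _
      cases b u <;> simp
  have h2 : coinAvg (fun b => (cnt fun u => a u && b u : ℝ)) +
      coinAvg (fun b => (cnt fun u => a u && b u : ℝ)) = cnt a := by
    nth_rw 2 [← coinAvg_not]
    rw [← coinAvg_add]
    simp only [h, coinAvg_const]
  linarith

theorem coinAvg_cnt_eq_zero (a : Fin n → Bool) :
    coinAvg (fun b => if (cnt fun u => a u && b u) = 0 then (1 : ℝ) else 0) =
      (1 / 2 : ℝ) ^ cnt a := by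
  rw [coinAvg_cnt_and a fun j => if j = 0 then (1 : ℝ) else 0]
  simp

/-- Since `C(k,j)/(j+1) = C(k+1,j+1)/(k+1)`, the average is a nearly complete binomial sum, at most
`2^(k+1)`, divided by `2^k (k+1)`. The resulting factor 2 is what one odd round of safety pays for.
-/
theorem coinAvg_one_div_cnt_succ_le (a : Fin n → Bool) :
    coinAvg (fun b => 1 / ((cnt fun u => a u && b u : ℕ) + 1 : ℝ)) ≤ 2 / (cnt a + 1) := by
  rw [coinAvg_cnt_and a fun j => 1 / (j + 1 : ℝ)]
  set k := cnt a
  have h1 : ∀ j ∈ Finset.range (k + 1), (k.choose j : ℝ) * (1 / (j + 1 : ℝ)) =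
      ((k + 1).choose (j + 1) : ℝ) / (k + 1) := by
    intro j _
    have := Nat.add_one_mul_choose_eq k j
    have h' : ((k : ℝ) + 1) * k.choose j = (k + 1).choose (j + 1) * (j + 1) := by
      exact_mod_cast this
    field_simp
    linarith
  rw [Finset.sum_congr rfl h1, ← Finset.sum_div]
  have h2 : (∑ j ∈ Finset.range (k + 1), ((k + 1).choose (j + 1) : ℝ)) ≤ 2 ^ (k + 1) := by
    have := Nat.sum_range_choose (k + 1)
    rw [Finset.sum_range_succ'] at this
    have h3 : (∑ j ∈ Finset.range (k + 1), ((k + 1).choose (j + 1) : ℝ)) + 1 = 2 ^ (k + 1) := by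
      exact_mod_cast this
    linarith
  rw [mul_div_assoc', div_le_div_iff_of_pos_right (by positivity)]
  calc (1 / 2 : ℝ) ^ k * ∑ j ∈ Finset.range (k + 1), ((k + 1).choose (j + 1) : ℝ)
      ≤ (1 / 2 : ℝ) ^ k * 2 ^ (k + 1) := by gcongr
    _ = 2 := by rw [pow_succ, ← mul_assoc, ← mul_pow]; norm_num

-- Fix two nodes of `a`. Flipping the coin of one of them destroys agreement, so at most one vector
-- in each flipped pair agrees.
open Classical in
theorem coinAvg_agree_le {a : Fin n → Bool} (ha : 2 ≤ cnt a) :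
    coinAvg (fun b => if ∀ u v, a u = true → a v = true → b u = b v then (1 : ℝ) else 0) ≤
      1 / 2 := by
  obtain ⟨u, v, hu, hv, huv⟩ : ∃ u v, a u = true ∧ a v = true ∧ u ≠ v := by
    by_contra! h
    have := cnt_le_one.2 h
    lia
  set F : (Fin n → Bool) → ℝ :=
    fun b => if ∀ u v, a u = true → a v = true → b u = b v then (1 : ℝ) else 0
  have h1 : ∀ b, F b + F (Function.update b u (!b u)) ≤ 1 := by
    intro b
    by_cases h : ∀ u v, a u = true → a v = true → b u = b v
    · have h2 : ¬∀ x y, a x = true → a y = true →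
          Function.update b u (!b u) x = Function.update b u (!b u) y := fun h' => by
        have := h' u v hu hv
        rw [Function.update_self, Function.update_of_ne huv.symm, h u v hu hv] at this
        simp at this
      simp only [F, if_neg h2, if_pos h, add_zero, le_refl]
    · simp only [F, if_neg h, zero_add]
      split_ifs <;> norm_num
  have h2 : coinAvg F + coinAvg F ≤ 1 := by
    nth_rw 2 [← coinAvg_flip u]
    rw [← coinAvg_add]
    exact coinAvg_le h1
  linarith

/-- The expected number of survivors of a knockout iteration, where a lone survivor of a silent
iteration counts for nothing. -/
theorem coinAvg_knockout_le (a : Fin n → Bool) :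
    coinAvg (fun b => (cnt fun u => a u && b u : ℝ) +
      (if 2 ≤ cnt a then (cnt a : ℝ) else 0) *
        if (cnt fun u => a u && b u) = 0 then (1 : ℝ) else 0) ≤ 3 / 4 * cnt a := by
  rw [coinAvg_add, coinAvg_mul_left, coinAvg_cnt, coinAvg_cnt_eq_zero]
  split_ifs with h
  -- With `k ≥ 2` nodes silence has probability at most 1/4, so the total is at most `k/2 + k/4`.
  · have : (1 / 2 : ℝ) ^ cnt a ≤ (1 / 2) ^ 2 :=
      pow_le_pow_of_le_one (by norm_num) (by norm_num) h
    nlinarith [(Nat.cast_nonneg (cnt a) : (0 : ℝ) ≤ cnt a)]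
  · linarith [(Nat.cast_nonneg (cnt a) : (0 : ℝ) ≤ cnt a)]

end Coins

/-! ### The algorithm as a coin-driven machine. -/

variable {K n : ℕ}

/-- The universal algorithm combined with the Constant State subroutine. -/
abbrev csMachine (K : ℕ) : Machine := universal (constantState K)

/-- The move of a node of `csMachine K`, as a function of the channel outcome, the current state
and a fair coin. -/
def csNext {K : ℕ} : Bool → UState (CState K) → Bool → UState (CState K)
  | false, .loop a ko _, _ => .sub a (.first ko)
  | true, .loop a ko p, b => if a && !p then .loop false true b else .loop a ko b
  | false, .sub a (.first _), b => .loop a false b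
  | true, .sub a (.first _), b => .sub a (.odd true true (a && b) 0)
  | h, .sub a (.odd solo att bp c), b =>
      .sub a (.even (solo && !(a && !bp && h)) att (att && b) c)
  | true, .sub a (.even solo att bp c), b => .sub a (.odd solo (att && bp) (a && b) c)
  | false, .sub a (.even solo _ _ c), b =>
      if h : (c : ℕ) + 1 < K + 1 then .sub a (.odd solo true (a && b) ⟨c + 1, h⟩)
      else .sub a (.last solo)
  | false, .sub a (.last _), _ => if a then .leader else .nonleader
  | true, .sub a (.last _), b => .loop a false b
  | _, .leader, _ => .leader
  | _, .nonleader, _ => .nonleader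

theorem universal_step_sub (T : TerminationSubroutine) (h a : Bool) (s : T.State) :
    (universal T).step h (.sub a s) = (T.step a h s).bind fun (r : T.State ⊕ Bool) =>
      show PMF (UState T.State) from match r with
      | .inl s' => PMF.pure (.sub a s')
      | .inr true => PMF.pure (if a then .leader else .nonleader)
      | .inr false => enterLoop a false := by
  cases h <;> rfl

theorem pure_eq_map_coin {α : Type*} (x : α) : PMF.pure x = coin.map fun _ => x :=
  (PMF.map_const coin x).symm

theorem constantState_step_first_true (a ko : Bool) :
    (constantState K).step a true (.first ko) =
      coin.map fun b => .inl (.odd true true (a && b) 0) := by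
  cases a
  · exact pure_eq_map_coin _
  · rfl

theorem constantState_step_odd (a h solo att bp : Bool) (c : Fin (K + 1)) :
    (constantState K).step a h (.odd solo att bp c) =
      coin.map fun b => .inl (.even (solo && !(a && !bp && h)) att (att && b) c) := by
  cases att
  · cases h <;> exact pure_eq_map_coin _
  · cases h <;> rfl

theorem constantState_step_even_true (a solo att bp : Bool) (c : Fin (K + 1)) :
    (constantState K).step a true (.even solo att bp c) =
      coin.map fun b => .inl (.odd solo (att && bp) (a && b) c) := by
  cases a
  · exact pure_eq_map_coin _
  · rfl

theorem constantState_step_even_false (a solo att bp : Bool) (c : Fin (K + 1)) :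
    (constantState K).step a false (.even solo att bp c) =
      if h : (c : ℕ) + 1 < K + 1 then
        coin.map fun b => .inl (.odd solo true (a && b) ⟨c + 1, h⟩)
      else PMF.pure (.inl (.last solo)) := by
  change (if h : (c : ℕ) + 1 < K + 1 then enterOdd a solo true ⟨c + 1, h⟩
    else PMF.pure (.inl (.last solo))) = _
  split_ifs
  · cases a
    · exact pure_eq_map_coin _
    · rfl
  · rfl

theorem universal_step_sub_map {T : TerminationSubroutine} {h a : Bool} {s : T.State}
    {g : Bool → T.State} (hs : T.step a h s = coin.map fun b => .inl (g b)) :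
    (universal T).step h (.sub a s) = coin.map fun b => .sub a (g b) := by
  rw [universal_step_sub, hs, PMF.bind_map]
  rfl

theorem universal_step_sub_pure {T : TerminationSubroutine} {h a : Bool} {s s' : T.State}
    (hs : T.step a h s = PMF.pure (.inl s')) :
    (universal T).step h (.sub a s) = coin.map fun _ => .sub a s' :=
  universal_step_sub_map (hs.trans (pure_eq_map_coin _))

theorem universal_step_sub_return_false {T : TerminationSubroutine} {h a : Bool} {s : T.State}
    (hs : T.step a h s = PMF.pure (.inr false)) :
    (universal T).step h (.sub a s) = coin.map fun b => .loop a false b := by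
  rw [universal_step_sub, hs]
  exact PMF.pure_bind _ _

theorem universal_step_sub_return_true {T : TerminationSubroutine} {h a : Bool} {s : T.State}
    (hs : T.step a h s = PMF.pure (.inr true)) :
    (universal T).step h (.sub a s) = coin.map fun _ => if a then .leader else .nonleader := by
  rw [universal_step_sub, hs]
  exact (PMF.pure_bind _ _).trans (pure_eq_map_coin _)

/-- No transition needs more than one coin. Deterministic moves ignore it, and nodes that must
listen mask it with `a && b` or `att && b`. Precision 2 is a consequence. -/
theorem csMachine_step (h : Bool) (s : (csMachine K).State) :
    (csMachine K).step h s = coin.map (csNext (K := K) h s) := by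
  rcases s with ⟨a, ko, p⟩ | ⟨a, ko | ⟨solo, att, bp, c⟩ | ⟨solo, att, bp, c⟩ | solo⟩ | _ | _
  · cases h <;> cases a <;> cases p <;> first | exact pure_eq_map_coin _ | rfl
  · cases h
    · exact universal_step_sub_return_false (T := constantState K) rfl
    · exact universal_step_sub_map (constantState_step_first_true a ko)
  · cases h <;> exact universal_step_sub_map (constantState_step_odd a _ solo att bp c)
  · cases h
    · by_cases hc : (c : ℕ) + 1 < K + 1
      · refine (universal_step_sub_map
          ((constantState_step_even_false a solo att bp c).trans (dif_pos hc))).trans ?_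
        congr 1
        funext b
        simp only [csNext, dif_pos hc]
        rfl
      · refine (universal_step_sub_pure
          ((constantState_step_even_false a solo att bp c).trans (dif_neg hc))).trans ?_
        congr 1
        funext b
        simp only [csNext, dif_neg hc]
        rfl
    · exact universal_step_sub_map (constantState_step_even_true a solo att bp c)
  · cases h
    · exact universal_step_sub_return_true (T := constantState K) rfl
    · exact universal_step_sub_return_false (T := constantState K) rfl
  · cases h <;> exact pure_eq_map_coin _
  · cases h <;> exact pure_eq_map_coin _

theorem map_coin_apply {α : Type*} [DecidableEq α] (f : Bool → α) (x : α) :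
    coin.map f x = (if x = f true then 2⁻¹ else 0) + if x = f false then 2⁻¹ else 0 := by
  rw [PMF.map_apply, tsum_fintype, Fintype.sum_bool, coin_apply, coin_apply]
  congr

theorem csMachine_hasPrecision : (csMachine K).HasPrecision 2 := by
  intro h s s'
  have key := map_coin_apply (csNext (K := K) h s) s'
  rw [csMachine_step]
  erw [key]
  split_ifs
  · exact Or.inr (Or.inl ENNReal.inv_two_add_inv_two)
  · exact Or.inr (Or.inr (by norm_num))
  · exact Or.inr (Or.inr (by norm_num))
  · exact Or.inl (add_zero 0)

/-- The operator sending `f` to its expectation after one round of `csMachine K`. -/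
abbrev csOp : ((csMachine K).Config n → ℝ) → (csMachine K).Config n → ℝ :=
  (csMachine K).roundOp (csNext (K := K))

/-! ### One-round recursions between synchronized configurations. -/

section Configurations

/-- All nodes are in the knockout loop. -/
def loopC (K : ℕ) (a ko p : Fin n → Bool) : (csMachine K).Config n :=
  fun u => UState.loop (a u) (ko u) (p u)

/-- All nodes are in the first round of the subroutine. -/
def firstC (K : ℕ) (a ko : Fin n → Bool) : (csMachine K).Config n :=
  fun u => UState.sub (a u) (CState.first (ko u))

/-- All nodes are in an odd round of the main body. -/
def oddC (a solo att bp : Fin n → Bool) (c : Fin (K + 1)) : (csMachine K).Config n :=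
  fun u => UState.sub (a u) (CState.odd (solo u) (att u) (bp u) c)

/-- All nodes are in an even round of the main body. -/
def evenC (a solo att bp : Fin n → Bool) (c : Fin (K + 1)) : (csMachine K).Config n :=
  fun u => UState.sub (a u) (CState.even (solo u) (att u) (bp u) c)

/-- All nodes are in the final round of the subroutine. -/
def lastC (K : ℕ) (a solo : Fin n → Bool) : (csMachine K).Config n :=
  fun u => UState.sub (a u) (CState.last (solo u))

/-- All nodes have returned. -/
def doneC (K : ℕ) (a : Fin n → Bool) : (csMachine K).Config n :=
  fun u => if a u then UState.leader else UState.nonleader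

variable (a ko p solo att bp : Fin n → Bool) (c : Fin (K + 1)) (b : Fin n → Bool)
  (f : (csMachine K).Config n → ℝ) (T : ℕ)

theorem nextConfig_eq {σ : (csMachine K).Config n} {h : Bool} (hb : (csMachine K).busy σ = h) :
    (csMachine K).nextConfig (csNext (K := K)) σ b = fun u => csNext h (σ u) (b u) := by
  subst hb
  rfl

theorem busy_true {σ : (csMachine K).Config n} (h : ∃ u, (csMachine K).beeps (σ u) = true) :
    (csMachine K).busy σ = true :=
  decide_eq_true h

theorem busy_false {σ : (csMachine K).Config n} (h : ¬∃ u, (csMachine K).beeps (σ u) = true) :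
    (csMachine K).busy σ = false :=
  decide_eq_false h

theorem csOp_iterate_succ {σ : (csMachine K).Config n} {τ : (Fin n → Bool) → (csMachine K).Config n}
    (h : ∀ b, (csMachine K).nextConfig (csNext (K := K)) σ b = τ b) :
    csOp^[T + 1] f σ = coinAvg fun b => csOp^[T] f (τ b) := by
  refine (Machine.roundOp_iterate_succ T f σ).trans ?_
  simp_rw [h]

theorem csOp_loop_busy (h : 0 < cnt fun u => a u && p u) :
    csOp^[T + 1] f (loopC K a ko p) = coinAvg fun b => csOp^[T] f
      (loopC K (fun u => a u && p u) (fun u => ko u || (a u && !p u)) b) := by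
  refine csOp_iterate_succ _ _ fun b => ?_
  rw [nextConfig_eq _ (busy_true (cnt_pos.1 h))]
  funext u
  simp only [loopC, csNext]
  cases a u <;> cases p u <;> simp <;> rfl

theorem csOp_loop_silent (h : (cnt fun u => a u && p u) = 0) :
    csOp^[T + 1] f (loopC K a ko p) = csOp^[T] f (firstC K a ko) := by
  rw [csOp_iterate_succ _ _ (τ := fun _ => firstC K a ko) fun b => ?_, coinAvg_const]
  rw [nextConfig_eq _ (busy_false (cnt_eq_zero.1 h))]
  rfl

theorem csOp_first_busy (h : ∃ u, ko u = true) :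
    csOp^[T + 1] f (firstC K a ko) = coinAvg fun b => csOp^[T] f
      (oddC a (fun _ => true) (fun _ => true) (fun u => a u && b u) 0) := by
  refine csOp_iterate_succ _ _ fun b => ?_
  rw [nextConfig_eq _ (busy_true h)]
  rfl

theorem csOp_first_silent (h : ¬∃ u, ko u = true) :
    csOp^[T + 1] f (firstC K a ko) = coinAvg fun b => csOp^[T] f
      (loopC K a (fun _ => false) b) := by
  refine csOp_iterate_succ _ _ fun b => ?_
  rw [nextConfig_eq _ (busy_false h)]
  rfl

open Classical in
theorem csOp_odd :
    csOp^[T + 1] f (oddC a solo att bp c) = coinAvg fun b => csOp^[T] f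
      (evenC a (fun u => solo u && !(a u && !bp u && decide (∃ v, bp v = true))) att
        (fun u => att u && b u) c) := by
  refine csOp_iterate_succ _ _ fun b => ?_
  by_cases h : ∃ v, bp v = true
  · rw [nextConfig_eq _ (busy_true h)]
    simp only [h, decide_true]
    rfl
  · rw [nextConfig_eq _ (busy_false h)]
    simp only [h, decide_false]
    rfl

theorem csOp_even_busy (h : ∃ u, bp u = true) :
    csOp^[T + 1] f (evenC a solo att bp c) = coinAvg fun b => csOp^[T] f
      (oddC a solo (fun u => att u && bp u) (fun u => a u && b u) c) := by
  refine csOp_iterate_succ _ _ fun b => ?_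
  rw [nextConfig_eq _ (busy_true h)]
  rfl

theorem csOp_even_silent_of_lt (h : ¬∃ u, bp u = true) (hc : (c : ℕ) + 1 < K + 1) :
    csOp^[T + 1] f (evenC a solo att bp c) = coinAvg fun b => csOp^[T] f
      (oddC a solo (fun _ => true) (fun u => a u && b u) ⟨c + 1, hc⟩) := by
  refine csOp_iterate_succ _ _ fun b => ?_
  rw [nextConfig_eq _ (busy_false h)]
  funext u
  simp only [evenC, csNext, dif_pos hc]
  rfl

theorem csOp_even_silent_of_eq (h : ¬∃ u, bp u = true) (hc : (c : ℕ) = K) :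
    csOp^[T + 1] f (evenC a solo att bp c) = csOp^[T] f (lastC K a solo) := by
  rw [csOp_iterate_succ _ _ (τ := fun _ => lastC K a solo) fun b => ?_, coinAvg_const]
  rw [nextConfig_eq _ (busy_false h)]
  funext u
  simp only [evenC, csNext, dif_neg (show ¬(c : ℕ) + 1 < K + 1 by lia)]
  rfl

theorem csOp_last_busy (h : ∃ u, a u = true ∧ solo u = false) :
    csOp^[T + 1] f (lastC K a solo) = coinAvg fun b => csOp^[T] f
      (loopC K a (fun _ => false) b) := by
  refine csOp_iterate_succ _ _ fun b => ?_
  rw [nextConfig_eq _ (busy_true ?_)]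
  · rfl
  · obtain ⟨u, hu, hs⟩ := h
    exact ⟨u, show (a u && !solo u) = true by simp [hu, hs]⟩

theorem csOp_last_silent (h : ∀ u, a u = true → solo u = true) :
    csOp^[T + 1] f (lastC K a solo) = csOp^[T] f (doneC K a) := by
  rw [csOp_iterate_succ _ _ (τ := fun _ => doneC K a) fun b => ?_, coinAvg_const]
  rw [nextConfig_eq _ (busy_false ?_)]
  · rfl
  · rintro ⟨u, hu⟩
    have hu : (a u && !solo u) = true := hu
    cases ha : a u
    · simp [ha] at hu
    · simp [ha, h u ha] at hu

theorem csNext_doneC (u : Fin n) (h b : Bool) :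
    csNext h (doneC K a u) b = doneC K a u := by
  unfold doneC
  cases a u <;> cases h <;> rfl

theorem nextConfig_doneC :
    (csMachine K).nextConfig (csNext (K := K)) (doneC K a) b = doneC K a :=
  funext fun u => csNext_doneC a u _ _

theorem csOp_done : csOp^[T] f (doneC K a) = f (doneC K a) := by
  induction T with
  | zero => rfl
  | succ T ih =>
    rw [csOp_iterate_succ _ _ fun b => nextConfig_doneC a b, coinAvg_const, ih]

end Configurations

/-! ### Safety: two leaders are unlikely. -/

section Safety

/-- The value of the bit `active` in a state, where returned nodes count as active if they are
leaders. -/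
def isActive {S : Type} : UState S → Bool
  | .loop a _ _ => a
  | .sub a _ => a
  | .leader => true
  | .nonleader => false

theorem isActive_of_csNext {h : Bool} {s : UState (CState K)} {b : Bool}
    (hs : isActive (csNext h s b) = true) : isActive s = true := by
  rcases s with ⟨a, ko, p⟩ | ⟨a, ko | ⟨solo, att, bp, c⟩ | ⟨solo, att, bp, c⟩ | solo⟩ | _ | _
  · cases h <;> cases a <;> cases p <;> simp_all [csNext, isActive]
  · cases h <;> simp_all [csNext, isActive]
  · cases h <;> simp_all [csNext, isActive]
  · cases h
    · simp only [csNext] at hs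
      split_ifs at hs <;> exact hs
    · exact hs
  · cases h <;> cases a <;> simp_all [csNext, isActive]
  · rfl
  · cases h <;> simp_all [csNext, isActive]

/-- The configurations with at least two leaders. -/
def twoLeaders (K n : ℕ) : Set ((csMachine K).Config n) :=
  {σ | ∃ u v, u ≠ v ∧ σ u = UState.leader ∧ σ v = UState.leader}

theorem nextConfig_mem_twoLeaders {σ : (csMachine K).Config n} (hσ : σ ∈ twoLeaders K n)
    (b : Fin n → Bool) : (csMachine K).nextConfig (csNext (K := K)) σ b ∈ twoLeaders K n := by
  obtain ⟨u, v, huv, hu, hv⟩ := hσ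
  refine ⟨u, v, huv, ?_, ?_⟩
  · simp only [Machine.nextConfig, hu]
    cases (csMachine K).busy σ <;> rfl
  · simp only [Machine.nextConfig, hv]
    cases (csMachine K).busy σ <;> rfl

/-- The indicator function of the configurations with at least two leaders. -/
def twoLeadersInd (K n : ℕ) : (csMachine K).Config n → ℝ := (twoLeaders K n).indicator 1

theorem twoLeadersInd_le_one (σ : (csMachine K).Config n) : twoLeadersInd K n σ ≤ 1 := by
  classical
  rw [twoLeadersInd, Set.indicator_apply]
  split_ifs
  · exact le_rfl
  · exact zero_le_one

theorem twoLeadersInd_eq_zero {σ : (csMachine K).Config n}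
    (h : ∀ u, σ u ≠ UState.leader) : twoLeadersInd K n σ = 0 :=
  Set.indicator_of_notMem (by rintro ⟨u, _, _, hu, _⟩; exact h u hu) _

/-- Activity is never regained and leaders count as active, so having at most one active node is
preserved and excludes two leaders. -/
theorem csOp_twoLeaders_eq_zero {σ : (csMachine K).Config n}
    (h : cnt (fun u => isActive (σ u)) ≤ 1) (T : ℕ) : csOp^[T] (twoLeadersInd K n) σ = 0 := by
  refine Machine.roundOp_iterate_eq_zero
    (A := {σ : (csMachine K).Config n | cnt (fun u => isActive (σ u)) ≤ 1}) ?_ ?_ T h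
  · intro σ hσ b
    exact (cnt_mono fun u hu => isActive_of_csNext hu).trans hσ
  · intro σ hσ
    refine Set.indicator_of_notMem ?_ _
    rintro ⟨u, v, huv, hu, hv⟩
    refine huv (cnt_le_one.1 hσ u v ?_ ?_)
    · rw [hu]; rfl
    · rw [hv]; rfl

/-- `1` if some node has been knocked out since the last call of the subroutine, else `0`. -/
def koBit (ko : Fin n → Bool) : ℝ := if ∃ u, ko u = true then 1 else 0

theorem koBit_nonneg (ko : Fin n → Bool) : 0 ≤ koBit ko := by
  unfold koBit
  split_ifs <;> norm_num

theorem koBit_le_one (ko : Fin n → Bool) : koBit ko ≤ 1 := by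
  unfold koBit
  split_ifs <;> norm_num

/-- An active node never heard another one. -/
abbrev AllSolo (a solo : Fin n → Bool) : Prop := ∀ u, a u = true → solo u = true

/-- All active nodes take the same decision. -/
abbrev Agree (a bp : Fin n → Bool) : Prop := ∀ u v, a u = true → a v = true → bp u = bp v

open Classical in
/-- Upper bounds on the probability that two leaders exist after `T` rounds, when the network
consists of `n` nodes, of which those in `a` are active. -/
structure SafetyBounds (K : ℕ) (a : Fin n → Bool) (T : ℕ) (r : ℝ) : Prop where
  loop : ∀ ko p, csOp^[T] (twoLeadersInd K n) (loopC K a ko p) ≤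
    r ^ (K + 1) * (cnt a - 1 + koBit ko)
  first : ∀ ko, csOp^[T] (twoLeadersInd K n) (firstC K a ko) ≤
    r ^ (K + 1) * (cnt a - 1 + koBit ko)
  odd : ∀ solo att bp c, csOp^[T] (twoLeadersInd K n) (oddC a solo att bp c) ≤
    r ^ (K + 1) * (cnt a - 1) + r ^ (K - c : ℕ) * (2 / (cnt att + 1)) *
      if AllSolo a solo ∧ Agree a bp then 1 else 0
  even : ∀ (solo att bp : Fin n → Bool) c, csOp^[T] (twoLeadersInd K n)
      (evenC a solo att (fun u => att u && bp u) c) ≤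
    r ^ (K + 1) * (cnt a - 1) + r ^ (K - c : ℕ) * (1 / ((cnt fun u => att u && bp u : ℕ) + 1)) *
      if AllSolo a solo then 1 else 0
  last : ∀ solo, csOp^[T] (twoLeadersInd K n) (lastC K a solo) ≤
    r ^ (K + 1) * (cnt a - 1) + if AllSolo a solo then 1 else 0

-- At least two active nodes agree with probability at most 1/2, which cancels the 2 in the `odd`
-- bound.
open Classical in
theorem SafetyBounds.odd_avg {a : Fin n → Bool} {T : ℕ} {r : ℝ} (h : SafetyBounds K a T r)
    (hr : 0 ≤ r) (ha : 2 ≤ cnt a) (solo att : Fin n → Bool) (c : Fin (K + 1)) :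
    coinAvg (fun b => csOp^[T] (twoLeadersInd K n)
      (oddC a solo att (fun u => a u && b u) c)) ≤
      r ^ (K + 1) * (cnt a - 1) + r ^ (K - c : ℕ) * (1 / (cnt att + 1)) *
        if AllSolo a solo then 1 else 0 := by
  have hnn : 0 ≤ r ^ (K - c : ℕ) * (2 / (cnt att + 1 : ℝ)) := by positivity
  refine (coinAvg_mono (G := fun b => r ^ (K + 1) * (cnt a - 1) +
    (r ^ (K - c : ℕ) * (2 / (cnt att + 1)) * if AllSolo a solo then 1 else 0) *
      if Agree a b then (1 : ℝ) else 0) fun b => ?_).trans ?_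
  · refine (h.odd solo att _ c).trans (add_le_add_right ?_ _)
    rw [mul_assoc _ (ite _ _ _)]
    refine mul_le_mul_of_nonneg_left ?_ hnn
    by_cases hs : AllSolo a solo
    · by_cases hb : Agree a b
      · simp only [if_pos hs, if_pos hb, mul_one]
        split_ifs <;> norm_num
      · rw [if_neg fun h' => hb fun u v hu hv => ?_]
        · simp only [if_pos hs, if_neg hb]
          norm_num
        · simpa [hu, hv] using h'.2 u v hu hv
    · simp [hs]
  · rw [coinAvg_add, coinAvg_const, coinAvg_mul_left]
    have hA := coinAvg_agree_le ha
    refine add_le_add_right ?_ _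
    refine (mul_le_mul_of_nonneg_left hA (mul_nonneg hnn (by split_ifs <;> norm_num))).trans
      (le_of_eq ?_)
    ring

/-- The term `cnt a - 1` is a budget for future knockouts, hence for future risky calls; `koBit`
accounts for the call already due. Inside a call, the second summand bounds the risk of that call:
`r^(K - c)` for the phases still to start, times the weight of the current attackers. The induction
runs over all `a` because knockouts shrink it. -/
theorem safetyBounds (hn : 1 ≤ n) (T : ℕ) (a : Fin n → Bool) (ha : 2 ≤ cnt a) :
    SafetyBounds K a T (1 / (n + 1 : ℝ)) := by
  classical
  set r : ℝ := 1 / (n + 1 : ℝ)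
  have hr : 0 ≤ r := by positivity
  induction T generalizing a with
  | zero =>
    have hk : (0 : ℝ) ≤ cnt a - 1 := by
      have : (2 : ℝ) ≤ cnt a := by exact_mod_cast ha
      linarith
    have hite : ∀ P : Prop, (0 : ℝ) ≤ if P then 1 else 0 := fun P => by split_ifs <;> norm_num
    refine ⟨fun ko p => ?_, fun ko => ?_, fun solo att bp c => ?_, fun solo att bp c => ?_,
      fun solo => ?_⟩ <;>
      refine (twoLeadersInd_eq_zero fun u hu => by
        simp [loopC, firstC, oddC, evenC, lastC] at hu).trans_le ?_
    · have := koBit_nonneg ko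
      positivity
    · have := koBit_nonneg ko
      positivity
    · have := hite (AllSolo a solo ∧ Agree a bp)
      positivity
    · have := hite (AllSolo a solo)
      positivity
    · have := hite (AllSolo a solo)
      positivity
  | succ T ih =>
    have hk : (0 : ℝ) ≤ cnt a - 1 := by
      have : (2 : ℝ) ≤ cnt a := by exact_mod_cast ha
      linarith
    have IH := ih a ha
    have hloop : coinAvg (fun b => csOp^[T] (twoLeadersInd K n)
        (loopC K a (fun _ => false) b)) ≤ r ^ (K + 1) * (cnt a - 1) :=
      coinAvg_le fun b => (IH.loop _ b).trans (by simp [koBit])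
    refine ⟨fun ko p => ?_, fun ko => ?_, fun solo att bp c => ?_, fun solo att bp c => ?_,
      fun solo => ?_⟩
    · have hko := koBit_nonneg ko
      rcases Nat.eq_zero_or_pos (cnt fun u => a u && p u) with h | h
      · rw [csOp_loop_silent _ _ _ _ _ h]
        exact IH.first ko
      · rw [csOp_loop_busy _ _ _ _ _ h]
        refine coinAvg_le fun b => ?_
        rcases le_or_gt (cnt fun u => a u && p u) 1 with h1 | h1
        · rw [csOp_twoLeaders_eq_zero h1]
          positivity
        · refine ((ih _ h1).loop _ b).trans (mul_le_mul_of_nonneg_left ?_ (by positivity))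
          -- If every active node participated, nothing changes. Otherwise some node is knocked out,
          -- and the loss of at least one in `cnt` pays for `koBit` becoming 1.
          by_cases hall : ∀ u, a u = true → p u = true
          · have h2 : (fun u => a u && p u) = a := by
              funext u
              cases hu : a u <;> simp [hall u, hu]
            have h3 : (fun u => ko u || (a u && !p u)) = ko := by
              funext u
              cases hu : a u <;> simp [hall u, hu]
            rw [h2, h3]
          · push Not at hall
            obtain ⟨v, hv, hpv⟩ := hall
            have h2 : cnt (fun u => a u && p u) + 1 ≤ cnt a :=
              cnt_lt (fun u hu => by simp at hu; exact hu.1) hv (by simp [hpv])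
            have h3 : ((cnt fun u => a u && p u : ℕ) : ℝ) + 1 ≤ cnt a := by exact_mod_cast h2
            linarith [koBit_le_one fun u => ko u || (a u && !p u)]
    · by_cases h : ∃ u, ko u = true
      · rw [csOp_first_busy _ _ _ _ h]
        -- All `n` nodes attack at first, so the weight `1/(n+1)` is `r` and completes `r^K` to
        -- `r^(K+1)`.
        refine (IH.odd_avg hr ha _ _ _).trans (le_of_eq ?_)
        rw [koBit, if_pos h, if_pos fun _ _ => rfl, cnt_true]
        change _ + r ^ (K - 0) * r * 1 = _
        rw [Nat.sub_zero]
        ring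
      · rw [csOp_first_silent _ _ _ _ h, koBit, if_neg h, add_zero]
        exact hloop
    · rw [csOp_odd]
      refine (coinAvg_mono (G := fun b => r ^ (K + 1) * (cnt a - 1) +
        (r ^ (K - c : ℕ) * if AllSolo a solo ∧ Agree a bp then 1 else 0) *
          (1 / ((cnt fun u => att u && b u : ℕ) + 1 : ℝ))) fun b => ?_).trans ?_
      · refine (IH.even _ att b c).trans (add_le_add_right ?_ _)
        rw [mul_assoc, mul_assoc, mul_comm (1 / _)]
        refine mul_le_mul_of_nonneg_left (mul_le_mul_of_nonneg_right ?_ (by positivity))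
          (by positivity)
        split_ifs with h1 h2
        · exact le_rfl
        -- Being solo after the odd round forces being solo before it and agreement in it: an active
        -- listener facing an active beeper would have reset `solo`.
        · refine absurd ⟨fun u hu => ?_, fun u v hu hv => ?_⟩ h2
          · have := h1 u hu
            simp at this
            exact this.1
          · have hu' := h1 u hu
            have hv' := h1 v hv
            cases h3 : bp u <;> cases h4 : bp v <;> simp [h3, h4, hu, hv] at hu' hv' ⊢
            · simp [hu'.2 v] at h4
            · simp [hv'.2 u] at h3
        · norm_num
        · exact le_rfl
      · rw [coinAvg_add, coinAvg_const, coinAvg_mul_left]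
        refine add_le_add_right ?_ _
        rw [mul_assoc _ (2 / _), mul_comm (2 / _), ← mul_assoc]
        exact mul_le_mul_of_nonneg_left (coinAvg_one_div_cnt_succ_le att)
          (mul_nonneg (by positivity) (by split_ifs <;> norm_num))
    · rcases Nat.eq_zero_or_pos (cnt fun u => att u && bp u) with h | h
      · rw [h]
        have hne := cnt_eq_zero.1 h
        rcases lt_or_ge ((c : ℕ) + 1) (K + 1) with hc | hc
        · rw [csOp_even_silent_of_lt _ _ _ _ _ _ _ hne hc]
          -- Silence means zero attackers and weight 1; the new phase starts with weight `r`,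
          -- matching the drop of the exponent from `K - c` to `K - (c + 1)`.
          refine (IH.odd_avg hr ha _ _ _).trans (le_of_eq ?_)
          rw [cnt_true]
          change _ + r ^ (K - (c + 1)) * r * _ = _
          rw [← pow_succ, show K - (c + 1) + 1 = K - (c : ℕ) by lia]
          simp
        · have hc' : (c : ℕ) = K := by lia
          rw [csOp_even_silent_of_eq _ _ _ _ _ _ _ hne hc']
          refine (IH.last _).trans (le_of_eq ?_)
          simp [hc']
      · rw [csOp_even_busy _ _ _ _ _ _ _ (cnt_pos.1 h)]
        refine (IH.odd_avg hr ha _ _ _).trans (le_of_eq ?_)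
        simp only [← Bool.and_assoc, Bool.and_self]
    · by_cases h : AllSolo a solo
      · rw [csOp_last_silent _ _ _ _ h, csOp_done, if_pos h]
        have := twoLeadersInd_le_one (doneC K a)
        have h0 : 0 ≤ r ^ (K + 1) * ((cnt a : ℝ) - 1) := by positivity
        linarith
      · rw [csOp_last_busy _ _ _ _ (by simpa [AllSolo] using h), if_neg h, add_zero]
        exact hloop

/-- The probability that two leaders exist after `T` rounds. -/
theorem csOp_twoLeaders_start_le (hn : 1 ≤ n) (T : ℕ) :
    csOp^[T] (twoLeadersInd K n) (firstC K (fun _ => true) fun _ => true) ≤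
      1 / (n + 1 : ℝ) ^ K := by
  rcases hn.eq_or_lt with rfl | hn'
  · rw [csOp_twoLeaders_eq_zero (cnt_le _)]
    positivity
  · refine ((safetyBounds hn T _ (by rwa [cnt_true])).first _).trans ?_
    have h1 := koBit_le_one fun _ : Fin n => true
    rw [cnt_true]
    calc (1 / (n + 1 : ℝ)) ^ (K + 1) * (n - 1 + koBit fun _ : Fin n => true)
        ≤ (1 / (n + 1 : ℝ)) ^ (K + 1) * (n + 1) := by gcongr; linarith
      _ = 1 / (n + 1 : ℝ) ^ K := by
        rw [pow_succ, one_div_pow]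
        field_simp

end Safety

/-! ### Termination: the election is unlikely to be pending for long. -/

section Termination

/-- The configurations in which all nodes have returned, at least one of them as leader. -/
def elected (K n : ℕ) : Set ((csMachine K).Config n) :=
  {σ | ∃ a : Fin n → Bool, (∃ u, a u = true) ∧ σ = doneC K a}

/-- The indicator function of the complement of `elected`. -/
def pendingInd (K n : ℕ) : (csMachine K).Config n → ℝ := (elected K n)ᶜ.indicator 1

theorem pendingInd_le_one (σ : (csMachine K).Config n) : pendingInd K n σ ≤ 1 := by
  classical
  rw [pendingInd, Set.indicator_apply]
  split_ifs
  · exact le_rfl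
  · exact zero_le_one

theorem pendingInd_doneC {a : Fin n → Bool} (ha : 1 ≤ cnt a) : pendingInd K n (doneC K a) = 0 :=
  Set.indicator_of_notMem (by rw [Set.notMem_compl_iff]; exact ⟨a, cnt_pos.1 ha, rfl⟩) _

theorem pendingInd_nextConfig_le (σ : (csMachine K).Config n) (b : Fin n → Bool) :
    pendingInd K n ((csMachine K).nextConfig (csNext (K := K)) σ b) ≤ pendingInd K n σ := by
  by_cases h : σ ∈ elected K n
  · obtain ⟨a, _, rfl⟩ := h
    rw [nextConfig_doneC]
  · have h1 : pendingInd K n σ = 1 := Set.indicator_of_mem (s := (elected K n)ᶜ) h _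
    rw [h1]
    exact pendingInd_le_one _

/-- The probability that the election is still pending after `T` rounds from `σ`. -/
abbrev pending (T : ℕ) (σ : (csMachine K).Config n) : ℝ := csOp^[T] (pendingInd K n) σ

theorem pending_le_one (T : ℕ) (σ : (csMachine K).Config n) : pending T σ ≤ 1 :=
  Machine.roundOp_iterate_le pendingInd_le_one T σ

theorem pending_antitone (σ : (csMachine K).Config n) : Antitone fun T => pending T σ :=
  Machine.roundOp_iterate_antitone pendingInd_nextConfig_le σ

variable {a : Fin n → Bool} {G : ℝ} {T₀ : ℕ}

/-- A continuation bound `hcont` is needed only for two or more active nodes: a lone one is still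
solo, so its call returns true. -/
theorem pending_last_le (ha : 1 ≤ cnt a) (hG : 0 ≤ G)
    (hcont : 2 ≤ cnt a → coinAvg (fun b => pending T₀ (loopC K a (fun _ => false) b)) ≤ G)
    {solo : Fin n → Bool} (hs : cnt a ≤ 1 → AllSolo a solo) :
    pending (T₀ + 1) (lastC K a solo) ≤ G := by
  by_cases h : AllSolo a solo
  · rw [pending, csOp_last_silent _ _ _ _ h, csOp_done, pendingInd_doneC ha]
    exact hG
  · rw [pending, csOp_last_busy _ _ _ _ (by simpa [AllSolo] using h)]
    exact hcont (by by_contra h2; exact h (hs (by lia)))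

/-- The coins for the next even round are drawn here, which halves the expected number of attackers.
A lone active node hears no beep other than its own, so it stays solo. -/
theorem pending_odd_le {T : ℕ} {x y : ℝ} {att : Fin n → Bool} {c : Fin (K + 1)}
    (h : ∀ solo bp : Fin n → Bool, (cnt a ≤ 1 → AllSolo a solo) →
      pending T (evenC a solo att (fun u => att u && bp u) c) ≤
        G + (cnt fun u => att u && bp u : ℕ) * x + y)
    {solo : Fin n → Bool} (hs : cnt a ≤ 1 → AllSolo a solo) :
    coinAvg (fun b => pending (T + 1) (oddC a solo att (fun u => a u && b u) c)) ≤
      G + cnt att / 2 * x + y := by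
  refine coinAvg_le fun b => ?_
  rw [pending, csOp_odd]
  refine (coinAvg_mono (G := fun b' : Fin n → Bool =>
    (G + y) + x * (cnt fun u => att u && b' u : ℕ)) fun b' => ?_).trans ?_
  · refine (h _ b' fun hk u hu => ?_).trans (le_of_eq (by ring))
    have h1 := hs hk u hu
    by_cases hb : ∃ v, (a v && b v) = true
    · obtain ⟨v, hv⟩ := hb
      simp only [Bool.and_eq_true] at hv
      have huv : u = v := cnt_le_one.1 hk u v hu hv.1
      simp [h1, show b u = true from huv ▸ hv.2]
    · rw [h1, decide_eq_false hb]
      simp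
  · rw [coinAvg_add, coinAvg_const, coinAvg_mul_left, coinAvg_cnt]
    exact le_of_eq (by ring)

/-- A first-moment argument: the expected number of attackers left bounds the probability that the
phase has not ended. At `j = 0` a nonzero count makes the bound at least 1; earlier silence is
handled by monotonicity in time. -/
theorem pending_even_le_of_silent (hG : 0 ≤ G) {T : ℕ} {y : ℝ} (hy : 0 ≤ y) {c : Fin (K + 1)}
    (hsil : ∀ solo att bp : Fin n → Bool, (cnt a ≤ 1 → AllSolo a solo) → (¬∃ u, bp u = true) →
      pending T (evenC a solo att bp c) ≤ G + y)
    (j : ℕ) (solo att bp : Fin n → Bool) (hs : cnt a ≤ 1 → AllSolo a solo) :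
    pending (T + 2 * j) (evenC a solo att (fun u => att u && bp u) c) ≤
      G + (cnt fun u => att u && bp u : ℕ) * (1 / 2) ^ j + y := by
  induction j generalizing solo att bp with
  | zero =>
    rcases Nat.eq_zero_or_pos (cnt fun u => att u && bp u) with h | h
    · rw [h]
      simpa using hsil solo att _ hs (cnt_eq_zero.1 h)
    · refine (pending_le_one _ _).trans ?_
      have : (1 : ℝ) ≤ (cnt fun u => att u && bp u : ℕ) := by exact_mod_cast h
      rw [pow_zero, mul_one]
      linarith
  | succ j ih =>
    rcases Nat.eq_zero_or_pos (cnt fun u => att u && bp u) with h | h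
    · rw [h]
      refine (pending_antitone _ (show T ≤ T + 2 * (j + 1) by lia)).trans ?_
      simpa using hsil solo att _ hs (cnt_eq_zero.1 h)
    · rw [show T + 2 * (j + 1) = (T + 2 * j + 1) + 1 by ring, pending,
        csOp_even_busy _ _ _ _ _ _ _ (cnt_pos.1 h)]
      simp only [← Bool.and_assoc, Bool.and_self]
      refine (pending_odd_le (fun solo' bp' hs' => ih solo' (fun u => att u && bp u) bp' hs')
        hs).trans (le_of_eq ?_)
      rw [pow_succ]
      ring

/-- Here `d` counts the phases still to start. Each restarts with `n` attackers, costs `2(t+1)`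
rounds and fails to end in time with probability at most `n 2^(-t)`. The extra 2 rounds are the last
silent even round and the final round. -/
theorem pending_even_le (ha : 1 ≤ cnt a) (hG : 0 ≤ G)
    (hcont : 2 ≤ cnt a → coinAvg (fun b => pending T₀ (loopC K a (fun _ => false) b)) ≤ G)
    (t d : ℕ) {c : Fin (K + 1)} (hc : c + d = K) (j : ℕ) (solo att bp : Fin n → Bool)
    (hs : cnt a ≤ 1 → AllSolo a solo) :
    pending (T₀ + 2 + 2 * (t + 1) * d + 2 * j) (evenC a solo att (fun u => att u && bp u) c) ≤
      G + (cnt fun u => att u && bp u : ℕ) * (1 / 2) ^ j + d * (n * (1 / 2) ^ t) := by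
  induction d generalizing c j solo att bp with
  | zero =>
    refine pending_even_le_of_silent hG (by positivity) (fun solo att bp hs hb => ?_)
      j solo att bp hs
    rw [pending, mul_zero, add_zero, csOp_even_silent_of_eq _ _ _ _ _ _ _ hb hc]
    refine (pending_last_le ha hG hcont hs).trans (le_of_eq ?_)
    simp
  | succ d ih =>
    refine pending_even_le_of_silent hG (by positivity) (fun solo att bp hs hb => ?_)
      j solo att bp hs
    have hc' : (c : ℕ) + 1 < K + 1 := by lia
    rw [show T₀ + 2 + 2 * (t + 1) * (d + 1) = (T₀ + 2 + 2 * (t + 1) * d + 2 * t + 1) + 1 by ring,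
      pending, csOp_even_silent_of_lt _ _ _ _ _ _ _ hb hc']
    refine (pending_odd_le (fun solo' bp' hs' => ih (c := ⟨c + 1, hc'⟩)
      (by simp only; lia) t solo' (fun _ => true) bp' hs') hs).trans ?_
    rw [cnt_true]
    have : (0 : ℝ) ≤ n * (1 / 2) ^ t := by positivity
    push_cast
    linarith

/-- A bound on the number of rounds of a call of the subroutine in which every phase consists of
at most `t + 1` pairs of rounds. -/
def callLength (K t : ℕ) : ℕ := 2 * (t + 1) * (K + 1) + 2

theorem pending_first_le (ha : 1 ≤ cnt a) (hG : 0 ≤ G)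
    (hcont : 2 ≤ cnt a → coinAvg (fun b => pending T₀ (loopC K a (fun _ => false) b)) ≤ G)
    (t : ℕ) {ko : Fin n → Bool} (hko : 2 ≤ cnt a ∨ ∃ u, ko u = true) :
    pending (T₀ + callLength K t) (firstC K a ko) ≤ G + (K + 1) * (n * (1 / 2) ^ t) := by
  have h0 : (0 : ℝ) ≤ n * (1 / 2) ^ t := by positivity
  by_cases h : ∃ u, ko u = true
  · rw [show T₀ + callLength K t = (T₀ + 2 + 2 * (t + 1) * K + 2 * t + 1) + 1 by
      unfold callLength; ring, pending, csOp_first_busy _ _ _ _ h]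
    refine (pending_odd_le (fun solo' bp' hs' => pending_even_le ha hG hcont t K (c := 0)
      (by simp) t solo' (fun _ => true) bp' hs') fun _ _ _ => rfl).trans ?_
    rw [cnt_true]
    linarith
  · refine (pending_antitone _ (show T₀ + 1 ≤ T₀ + callLength K t by
      unfold callLength; lia)).trans ?_
    simp only [pending]
    rw [csOp_first_silent _ _ _ _ h]
    refine (hcont (hko.resolve_right h)).trans ?_
    have : (0 : ℝ) ≤ (K + 1) * (n * (1 / 2) ^ t) := by positivity
    linarith

/-- The hypothesis `hko` is an invariant: a node becomes the only active one through a knockout, so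
`ko` is still set somewhere. The next silent iteration then triggers a full call, which elects it,
instead of a call that immediately returns false. -/
theorem pending_loop_le (t J : ℕ) {a ko : Fin n → Bool} (ha : 1 ≤ cnt a)
    (hko : 2 ≤ cnt a ∨ ∃ u, ko u = true) :
    coinAvg (fun b => pending (J * (callLength K t + 1)) (loopC K a ko b)) ≤
      cnt a * (3 / 4) ^ J + J * ((K + 1) * (n * (1 / 2) ^ t)) := by
  induction J generalizing a ko with
  | zero =>
    refine coinAvg_le fun b => (pending_le_one _ _).trans ?_
    have : (1 : ℝ) ≤ cnt a := by exact_mod_cast ha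
    simpa using this
  | succ J ih =>
    set ε : ℝ := (K + 1) * (n * (1 / 2) ^ t)
    have hε : 0 ≤ ε := by positivity
    have hJ : (J + 1) * (callLength K t + 1) =
      (J * (callLength K t + 1) + callLength K t) + 1 := by ring
    have key : ∀ b : Fin n → Bool, pending ((J + 1) * (callLength K t + 1)) (loopC K a ko b) ≤
        (J + 1 : ℕ) * ε + (3 / 4) ^ J * ((cnt fun u => a u && b u : ℕ) +
          (if 2 ≤ cnt a then (cnt a : ℝ) else 0) *
            if (cnt fun u => a u && b u) = 0 then (1 : ℝ) else 0) := by
      intro b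
      rw [hJ, pending]
      rcases Nat.eq_zero_or_pos (cnt fun u => a u && b u) with h | h
      · rw [csOp_loop_silent _ _ _ _ _ h, h]
        -- The continuation value is zero for a lone active node, which is what makes the
        -- contraction factor 3/4 available.
        refine (pending_first_le (G := (if 2 ≤ cnt a then (cnt a : ℝ) else 0) * (3 / 4) ^ J + J * ε)
          ha (by positivity) (fun h2 => ?_) t hko).trans (le_of_eq ?_)
        · rw [if_pos h2]
          exact ih ha (Or.inl h2)
        · rw [if_pos rfl]
          push_cast
          ring
      · rw [csOp_loop_busy _ _ _ _ _ h]
        -- A busy iteration takes a single round; the rounds reserved for a call are discarded.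
        refine (coinAvg_mono fun b' => pending_antitone _ (Nat.le_add_right _ _)).trans ?_
        refine (ih h ?_).trans ?_
        · by_cases hall : ∀ u, a u = true → b u = true
          · have h2 : (fun u => a u && b u) = a := by
              funext u
              cases hu : a u <;> simp [hall u, hu]
            rw [h2]
            exact hko.imp_right fun ⟨u, hu⟩ => ⟨u, by simp [hu]⟩
          · push Not at hall
            obtain ⟨v, hv, hbv⟩ := hall
            exact Or.inr ⟨v, by simp [hv, hbv]⟩
        · rw [if_neg h.ne']
          push_cast
          linarith
    refine (coinAvg_mono key).trans ?_
    rw [coinAvg_add, coinAvg_const, coinAvg_mul_left, pow_succ]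
    have := mul_le_mul_of_nonneg_left (coinAvg_knockout_le a)
      (show (0 : ℝ) ≤ (3 / 4) ^ J by positivity)
    linarith

/-- The number of rounds granted to the algorithm. -/
def totalRounds (K J : ℕ) : ℕ := J * (callLength K J + 1) + callLength K J

/-- Absorbs the overrun errors of all `J + 1` calls into the knockout rate `(3/4)^J`. -/
theorem succ_mul_half_pow_le (J : ℕ) : (J + 1 : ℝ) * (1 / 2) ^ J ≤ 2 * (3 / 4) ^ J := by
  induction J with
  | zero => norm_num
  | succ J ih =>
    have h : (1 / 2 : ℝ) ^ J ≤ (3 / 4) ^ J := pow_le_pow_left₀ (by norm_num) (by norm_num) J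
    rw [pow_succ, pow_succ]
    push_cast
    linarith

theorem pending_start_le (hn : 1 ≤ n) (J : ℕ) :
    pending (totalRounds K J) (firstC K (fun _ : Fin n => true) fun _ => true) ≤
      n * (2 * K + 3) * (3 / 4) ^ J := by
  have hk : cnt (fun _ : Fin n => true) = n := cnt_true
  have h := pending_first_le (K := K) (a := fun _ : Fin n => true) (T₀ := J * (callLength K J + 1))
    (G := n * (3 / 4) ^ J + J * ((K + 1) * (n * (1 / 2) ^ J))) (by rwa [hk]) (by positivity)
    (fun h2 => by simpa only [hk] using
      pending_loop_le J J (ko := fun _ => false) (by rwa [hk]) (Or.inl h2))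
    J (ko := fun _ => true) (Or.inr ⟨⟨0, hn⟩, rfl⟩)
  refine h.trans ?_
  have h1 := mul_le_mul_of_nonneg_left (succ_mul_half_pow_le J)
    (show (0 : ℝ) ≤ (K + 1) * n by positivity)
  linarith

theorem totalRounds_le {J : ℕ} (hJ : 1 ≤ J) :
    (totalRounds K J : ℝ) ≤ 2 * (4 * K + 7) * (J : ℝ) ^ 2 := by
  obtain ⟨j, rfl⟩ := Nat.exists_eq_add_of_le' hJ
  -- The witness `k` is the exact difference of the two sides, so `ring` suffices over the naturals.
  have h : totalRounds K (j + 1) ≤ 2 * (4 * K + 7) * (j + 1) ^ 2 :=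
    Nat.le.intro (k := 6 * K * j ^ 2 + 8 * K * j + 12 * j ^ 2 + 17 * j + 1) <| by
      unfold totalRounds callLength
      ring
  exact_mod_cast h

end Termination

/-! ### From bounds at fixed times to events of the whole execution. -/

section Execution

variable {M : Machine} {next : Bool → M.State → Bool → M.State}

/-- Since `A` is almost surely never left, having visited it by time `T` means being in it at `T`.
Continuity from below then passes to the union over `T` without a union bound. -/
theorem Machine.measureReal_exists_mem_le (hM : ∀ h s, M.step h s = coin.map (next h s))
    {A : Set (M.Config n)} (hA : ∀ σ ∈ A, ∀ b, M.nextConfig next σ b ∈ A) {ε : ℝ} (hε : 0 ≤ ε)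
    (h : ∀ T, (M.executionLaw n).real {ω | ω T ∈ A} ≤ ε) :
    (M.executionLaw n).real {ω | ∃ t, ω t ∈ A} ≤ ε := by
  have h1 : {ω : ℕ → M.Config n | ∃ t, ω t ∈ A} = ⋃ T, {ω | ∃ t ≤ T, ω t ∈ A} := by
    ext ω
    simp only [Set.mem_ofPred_eq, Set.mem_iUnion]
    exact ⟨fun ⟨t, ht⟩ => ⟨t, t, le_rfl, ht⟩, fun ⟨_, t, _, ht⟩ => ⟨t, ht⟩⟩
  have hmono : Monotone fun T => {ω : ℕ → M.Config n | ∃ t ≤ T, ω t ∈ A} :=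
    fun T T' hT ω ⟨t, ht, hω⟩ => ⟨t, ht.trans hT, hω⟩
  refine ENNReal.toReal_le_of_le_ofReal hε ?_
  rw [h1, hmono.measure_iUnion]
  refine iSup_le fun T => ?_
  refine (measure_mono_ae ?_).trans
    ((ENNReal.le_ofReal_iff_toReal_le (measure_ne_top _ _) hε).2 (h T))
  filter_upwards [execution_mem_succ hM hA] with ω hω ⟨t, ht, htA⟩
  exact Nat.le_induction htA (fun s _ hs => hω s hs) T ht

theorem measureReal_not_elected (T : ℕ) :
    ((csMachine K).executionLaw n).real {ω | ω T ∉ elected K n} =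
      pending T (firstC K (fun _ : Fin n => true) fun _ => true) :=
  Machine.measure_execution csMachine_step T (elected K n)ᶜ

theorem measureReal_not_elected_le (hn : 1 ≤ n) (J : ℕ) :
    ((csMachine K).executionLaw n).real {ω | ω (totalRounds K J) ∉ elected K n} ≤
      n * (2 * K + 3) * (3 / 4) ^ J :=
  (measureReal_not_elected _).trans_le (pending_start_le hn J)

theorem isTerminal_leader : (csMachine K).IsTerminal UState.leader := by
  intro b
  cases b <;> rfl

theorem isTerminal_nonleader : (csMachine K).IsTerminal UState.nonleader := by
  intro b
  cases b <;> rfl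

theorem isTerminal_of_mem_elected {σ : (csMachine K).Config n} (h : σ ∈ elected K n) (u : Fin n) :
    (csMachine K).IsTerminal (σ u) := by
  obtain ⟨a, _, rfl⟩ := h
  unfold doneC
  cases a u
  · exact isTerminal_nonleader
  · exact isTerminal_leader

/-- The probability of never being elected is below `n (2K+3) (3/4)^J` for every `J`, hence zero. -/
theorem ae_exists_leader (hn : 1 ≤ n) :
    ∀ᵐ ω ∂((csMachine K).executionLaw n), ∃ t u, ω t u = leaderState (constantState K) := by
  have h0 : ((csMachine K).executionLaw n).real {ω | ∀ t, ω t ∉ elected K n} ≤ 0 := by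
    have hlim : Filter.Tendsto (fun J : ℕ => (n * (2 * K + 3) : ℝ) * (3 / 4) ^ J) Filter.atTop
        (nhds 0) := by
      simpa using (tendsto_pow_atTop_nhds_zero_of_lt_one (by norm_num : (0 : ℝ) ≤ 3 / 4)
        (by norm_num)).const_mul (n * (2 * K + 3) : ℝ)
    refine ge_of_tendsto' hlim fun J => ?_
    refine le_trans (measureReal_mono ?_) (measureReal_not_elected_le hn J)
    exact fun ω hω => hω (totalRounds K J)
  have h1 : (csMachine K).executionLaw n {ω | ∀ t, ω t ∉ elected K n} = 0 :=
    (measureReal_eq_zero_iff).1 (le_antisymm h0 measureReal_nonneg)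
  have h2 : ∀ᵐ ω ∂((csMachine K).executionLaw n), ¬∀ t, ω t ∉ elected K n :=
    measure_eq_zero_iff_ae_notMem.1 h1
  filter_upwards [h2] with ω hω
  push Not at hω
  obtain ⟨t, a, ⟨u, hu⟩, ht⟩ := hω
  refine ⟨t, u, ?_⟩
  rw [ht, doneC, hu]
  rfl

theorem measureReal_twoLeaders_le (hn : 1 ≤ n) :
    ((csMachine K).executionLaw n).real {ω | ∃ t, ω t ∈ twoLeaders K n} ≤
      1 / (n + 1 : ℝ) ^ K :=
  Machine.measureReal_exists_mem_le csMachine_step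
    (fun _ hσ b => nextConfig_mem_twoLeaders hσ b) (by positivity) fun T =>
    (Machine.measure_execution csMachine_step T _).trans_le (csOp_twoLeaders_start_le hn T)

theorem one_sub_le_measureReal {Ω : Type*} [MeasurableSpace Ω] {μ : Measure Ω}
    [IsProbabilityMeasure μ] {s t : Set Ω} {ε : ℝ} (h : ∀ ω, ω ∉ s → ω ∈ t) (ht : μ.real t ≤ ε) :
    1 - ε ≤ μ.real s := by
  have h1 : s ∪ t = Set.univ := Set.eq_univ_of_forall fun ω => or_iff_not_imp_left.2 (h ω)
  have h2 := measureReal_union_le (μ := μ) s t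
  rw [h1, probReal_univ] at h2
  linarith

theorem solvesLeaderElection (hn : 1 ≤ n) {c : ℝ} (hc : c ≤ K) :
    (csMachine K).SolvesLeaderElection (leaderState (constantState K)) n (1 / (n : ℝ) ^ c) := by
  refine ⟨isTerminal_leader, ae_exists_leader hn, ?_⟩
  have hn' : (1 : ℝ) ≤ n := by exact_mod_cast hn
  have hle : 1 / (n + 1 : ℝ) ^ K ≤ 1 / (n : ℝ) ^ c := by
    refine one_div_le_one_div_of_le (by positivity) ?_
    calc (n : ℝ) ^ c ≤ (n : ℝ) ^ (K : ℝ) := Real.rpow_le_rpow_of_exponent_le hn' hc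
      _ = (n : ℝ) ^ K := Real.rpow_natCast _ _
      _ ≤ (n + 1 : ℝ) ^ K := by gcongr; linarith
  refine one_sub_le_measureReal (fun ω hω => ?_) ((measureReal_twoLeaders_le hn).trans hle)
  by_contra h
  exact hω fun t u v hu hv => by_contra fun huv => h ⟨t, u, v, huv, hu, hv⟩

theorem one_sub_le_measureReal_terminatesWithin (hn : 1 ≤ n) {J : ℕ} {r ε : ℝ}
    (hr : totalRounds K J ≤ r) (hε : n * (2 * K + 3) * (3 / 4) ^ J ≤ ε) :
    1 - ε ≤ ((csMachine K).executionLaw n).real {ω | (csMachine K).TerminatesWithin ω r} := by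
  refine one_sub_le_measureReal (fun ω hω => ?_) ((measureReal_not_elected_le hn J).trans hε)
  intro h
  exact hω ⟨totalRounds K J, hr, fun u => isTerminal_of_mem_elected h u⟩

end Execution

/-- For every exponent `c`, logarithmically many iterations suffice. -/
theorem exists_iterations (K : ℕ) {c : ℝ} (hc : 0 < c) : ∃ A : ℝ, ∀ n : ℕ, 2 ≤ n → ∃ J : ℕ,
    1 ≤ J ∧ (J : ℝ) ≤ A * Real.log n ∧
      (n * (2 * K + 3) * (3 / 4) ^ J : ℝ) ≤ 1 / (n : ℝ) ^ c := by
  have hq : 0 < Real.log (4 / 3) := Real.log_pos (by norm_num)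
  have h2 : 0 < Real.log 2 := Real.log_pos (by norm_num)
  have hK : (0 : ℝ) < 2 * K + 3 := by positivity
  have hlK : 0 ≤ Real.log (2 * K + 3) :=
    Real.log_nonneg (by linarith [(Nat.cast_nonneg K : (0 : ℝ) ≤ K)])
  -- After taking logarithms, `J log(4/3)` must cover `(1+c) log n + log(2K+3)`; the constant term
  -- is absorbed using `log n / log 2 ≥ 1`. The added `1 / log 2` below absorbs the rounding up of
  -- `J` in the same way.
  set B : ℝ := (1 + c + Real.log (2 * K + 3) / Real.log 2) / Real.log (4 / 3) with hB
  refine ⟨B + 1 / Real.log 2, fun n hn => ⟨⌈B * Real.log n⌉₊, ?_, ?_, ?_⟩⟩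
  all_goals
    have hn0 : (0 : ℝ) < n := by positivity
    have hlog : Real.log 2 ≤ Real.log n :=
      Real.log_le_log (by norm_num) (by exact_mod_cast hn)
    have hBpos : 0 < B := by positivity
    have hlogn : 0 < Real.log n := h2.trans_le hlog
  · exact Nat.ceil_pos.2 (by positivity)
  · have h1 : 1 ≤ 1 / Real.log 2 * Real.log n := by
      rw [one_div, inv_mul_eq_div, one_le_div h2]
      exact hlog
    have := Nat.ceil_lt_add_one (show 0 ≤ B * Real.log n by positivity)
    linarith
  · set J := ⌈B * Real.log n⌉₊
    have hJ : B * Real.log n ≤ J := Nat.le_ceil _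
    rw [← Real.log_le_log_iff (by positivity) (by positivity),
      Real.log_mul (by positivity) (by positivity), Real.log_mul hn0.ne' hK.ne', Real.log_pow,
      one_div, Real.log_inv, Real.log_rpow hn0, show (3 / 4 : ℝ) = (4 / 3)⁻¹ by norm_num,
      Real.log_inv]
    have h3 : B * Real.log n * Real.log (4 / 3) ≤ J * Real.log (4 / 3) := by gcongr
    have h4 : B * Real.log n * Real.log (4 / 3) =
        (1 + c) * Real.log n + Real.log (2 * K + 3) * (Real.log n / Real.log 2) := by
      rw [hB]
      field_simp
    have h5 : Real.log (2 * K + 3) * 1 ≤ Real.log (2 * K + 3) * (Real.log n / Real.log 2) :=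
      mul_le_mul_of_nonneg_left ((one_le_div h2).2 hlog) hlK
    linarith

end Beeping

end

theorem mainTheorem5 :
    ∀ c : ℝ, 0 < c → ∃ (K s : ℕ) (C : ℝ),
      Fintype.card (Beeping.universal (Beeping.constantState K)).State ≤ s ∧
      (Beeping.universal (Beeping.constantState K)).HasPrecision 2 ∧
      ∀ n : ℕ, 1 ≤ n →
        (Beeping.universal (Beeping.constantState K)).SolvesLeaderElection
          (Beeping.leaderState (Beeping.constantState K)) n (1 / (n : ℝ) ^ c) ∧
        1 - 1 / (n : ℝ) ^ c ≤
          ((Beeping.universal (Beeping.constantState K)).executionLaw n).real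
            {ω | (Beeping.universal (Beeping.constantState K)).TerminatesWithin ω
              (C * Real.log n ^ 2)} := by
  intro c hc
  obtain ⟨A, hA⟩ := Beeping.exists_iterations ⌈c⌉₊ hc
  refine ⟨⌈c⌉₊, _, 2 * (4 * ⌈c⌉₊ + 7) * A ^ 2, le_rfl, Beeping.csMachine_hasPrecision,
    fun n hn => ⟨Beeping.solvesLeaderElection hn (Nat.le_ceil c), ?_⟩⟩
  -- For `n = 1` the time bound is 0, but the required probability `1 - 1` is 0 as well.
  rcases hn.eq_or_lt with rfl | hn2
  · simp [MeasureTheory.measureReal_nonneg]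
  · obtain ⟨J, hJ1, hJ, hε⟩ := hA n hn2
    refine Beeping.one_sub_le_measureReal_terminatesWithin hn ?_ hε
    refine (Beeping.totalRounds_le hJ1).trans ?_
    rw [mul_assoc (2 * (4 * (⌈c⌉₊ : ℝ) + 7)), ← mul_pow]
    gcongr
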